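/- Let $S^2\subset\mathbb R^3$ be the unit sphere, with spherical coordinates $(x,y,z)=(-\sin\theta\cos\phi,-\sin\theta\sin\phi,\cos\theta)$ and corresponding momenta $p_\theta,p_\phi$ on the cotangent bundle $T^*S^2$. Let $s,A,c,A_1\in\mathbb R$ with $s>1$, and put $W(z)=z+s$, $P(z)=3z^2+4sz+1$ and $G(z)=P(z)/(2W(z))^2$. Let $K,K_1:T^*S^2\to\mathbb R$ and $V,V_1:S^2\to\mathbb R$ be the analytic continuations to the whole of $T^*S^2$ and $S^2$ of the functions \[ K=\tfrac12\Big(\frac1{\sin^2\theta}+G(\cos\theta)\Big)p_\phi^2+\tfrac12p_\theta^2,\qquad V=A\,\frac{\sin\theta}{\sqrt{W(\cos\theta)}}\cos\phi+\frac{c}{W(\cos\theta)}, \] \[ K_1=\tfrac12\Big(\frac{\cos^2\theta}{\sin^2\theta}+4\Big)p_\phi^2+\tfrac12p_\theta^2,\qquad V_1=A_1\sin\theta\sin\phi . \] Thus $H=K+V$ is the Hamiltonian of the new system and $H_1=K_1+V_1$ is the Hamiltonian of the reduced Goryachev--Chaplygin system. For a diffeomorphism $D$ of $S^2$, write $D_*$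 for the push-forward of functions on $S^2$ (along $D$) and of functions on $T^*S^2$ (along the map of $T^*S^2$ induced by $D$). Then there are no smooth diffeomorphism $D:S^2\to S^2$ and constants $\alpha,\beta\in\mathbb R$ such that $D_*K=\alpha K_1$ and $D_*V=\beta V_1$. Hence the new system is not the reduced Goryachev--Chaplygin system: there are no smooth diffeomorphism $D:S^2\to S^2$ and constant $\alpha\in\mathbb R$ such that $D_*H=\alpha H_1$. -/

import Mathlib

open scoped Manifold ContDiff

namespace SphereSystem

noncomputable section

/-- The unit sphere `S²` in `ℝ³`, with Mathlib's smooth structure. -/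
abbrev S2 : Type := Metric.sphere (0 : EuclideanSpace ℝ (Fin 3)) 1

/-- The cotangent space of `S²` at `q`. -/
abbrev Cotangent (q : S2) : Type := TangentSpace (𝓡 2) q →L[ℝ] ℝ

/-- Real functions on the cotangent bundle `T*S²`, written `f q p` with `p` a covector at `q`. -/
abbrev CotangentFunction : Type := (q : S2) → Cotangent q → ℝ

/-- First Cartesian coordinate of a point of the sphere. -/
def xc (q : S2) : ℝ := (q : EuclideanSpace ℝ (Fin 3)) 0
/-- Second Cartesian coordinate of a point of the sphere. -/
def yc (q : S2) : ℝ := (q : EuclideanSpace ℝ (Fin 3)) 1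
/-- Third Cartesian coordinate of a point of the sphere. -/
def zc (q : S2) : ℝ := (q : EuclideanSpace ℝ (Fin 3)) 2

/-- The differential at `q` of the inclusion `S² → ℝ³`. -/
def inclusionDeriv (q : S2) : TangentSpace (𝓡 2) q →L[ℝ] EuclideanSpace ℝ (Fin 3) :=
  mvfderiv (𝓡 2) ((↑) : S2 → EuclideanSpace ℝ (Fin 3)) q

/-- The tangent vector of `S²` at `q` that the inclusion into `ℝ³` sends to `w`, where `w` is
orthogonal to `q`. -/
def tangentVector (q : S2) (w : EuclideanSpace ℝ (Fin 3)) : TangentSpace (𝓡 2) q :=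
  Function.invFun (inclusionDeriv q) w

theorem finrank_three : Fact (Module.finrank ℝ (EuclideanSpace ℝ (Fin 3)) = 2 + 1) :=
  ⟨by simp⟩

theorem inclusionDeriv_injective (q : S2) : Function.Injective (inclusionDeriv q) :=
  have := finrank_three
  injective_mvfderiv_subtypeVal_sphere (n := 2) q

theorem inclusionDeriv_tangentVector (q : S2) (w : EuclideanSpace ℝ (Fin 3))
    (hw : inner ℝ (q : EuclideanSpace ℝ (Fin 3)) w = 0) :
    inclusionDeriv q (tangentVector q w) = w := by
  have := finrank_three
  have h := range_mvfderiv_subtypeVal (n := 2) q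
  have hm : w ∈ (Submodule.span ℝ {(q : EuclideanSpace ℝ (Fin 3))})ᗮ :=
    (Submodule.mem_orthogonal_singleton_iff_inner_right).2 hw
  rw [← h] at hm
  obtain ⟨v, hv⟩ := hm
  exact Function.invFun_eq ⟨v, hv⟩

/-- The angular momentum `L_x = y p_z - z p_y`: the covector evaluated on the generator of the
rotations about the `x`-axis. -/
def Lx : CotangentFunction := fun q p => p (tangentVector q !₂[0, -zc q, yc q])
/-- The angular momentum `L_y = z p_x - x p_z`. -/
def Ly : CotangentFunction := fun q p => p (tangentVector q !₂[zc q, 0, -xc q])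
/-- The angular momentum `L_z = x p_y - y p_x`. -/
def Lz : CotangentFunction := fun q p => p (tangentVector q !₂[-yc q, xc q, 0])

/-- `W(z) = z + s`. -/
def W (s z : ℝ) : ℝ := z + s

/-- `P(z) = 3z² + 4sz + 1`. -/
def P (s z : ℝ) : ℝ := 3 * z ^ 2 + 4 * s * z + 1

/-- `G(z) = P(z) / (2 W(z))²`. -/
def G (s z : ℝ) : ℝ := P s z / (2 * W s z) ^ 2

/-- The kinetic energy of the new system, on the cotangent bundle of the whole sphere;
`K_sphericalPoint` below is its expression in spherical coordinates. -/
def K (s : ℝ) : CotangentFunction := fun q p =>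
  (1 / 2) * (Lx q p ^ 2 + Ly q p ^ 2 + (1 + G s (zc q)) * Lz q p ^ 2)

/-- The potential of the new system. -/
def V (s A c : ℝ) (q : S2) : ℝ :=
  -A * (xc q / Real.sqrt (W s (zc q))) + c / W s (zc q)

/-- The Hamiltonian `H = K + V` of the new system. -/
def H (s A c : ℝ) : CotangentFunction := fun q p => K s q p + V s A c q

/-- The kinetic energy of the reduced Goryachev-Chaplygin system. -/
def K₁ : CotangentFunction := fun q p =>
  (1 / 2) * (Lx q p ^ 2 + Ly q p ^ 2 + 4 * Lz q p ^ 2)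

/-- The potential of the reduced Goryachev-Chaplygin system. -/
def V₁ (A₁ : ℝ) (q : S2) : ℝ := -A₁ * yc q

/-- The Hamiltonian `H₁ = K₁ + V₁` of the reduced Goryachev-Chaplygin system. -/
def H₁ (A₁ : ℝ) : CotangentFunction := fun q p => K₁ q p + V₁ A₁ q

/-- The push-forward `D_* f = f ∘ (D^*)` of a function on `T*S²` under a diffeomorphism `D`:
with `T = d(D⁻¹)_q`, which maps `T_q S²` isomorphically onto `T_{D⁻¹ q} S²`, its value at the
covector `p` at `q` is the value of `f` at the covector `p ∘ T⁻¹` at `D⁻¹ q`. -/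
def pushforward (D : S2 ≃ₘ⟮𝓡 2, 𝓡 2⟯ S2) (f : CotangentFunction) : CotangentFunction :=
  fun q p => f (D.symm q)
    (p.comp ((D.symm.mfderivToContinuousLinearEquiv (x := q) (by simp)).symm :
      TangentSpace (𝓡 2) (D.symm q) →L[ℝ] TangentSpace (𝓡 2) q))

/-- The push-forward `D_* v = v ∘ D⁻¹` of a function on `S²` under a diffeomorphism `D`. -/
def pushforwardBase (D : S2 ≃ₘ⟮𝓡 2, 𝓡 2⟯ S2) (v : S2 → ℝ) : S2 → ℝ := fun q => v (D.symm q)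

/-! ### Expressions in spherical coordinates -/

/-- The point of the sphere with spherical coordinates `(θ, φ)`, in the convention
`(x, y, z) = (-sin θ cos φ, -sin θ sin φ, cos θ)`. -/
def sphericalPoint (θ φ : ℝ) : S2 :=
  ⟨!₂[-(Real.sin θ * Real.cos φ), -(Real.sin θ * Real.sin φ), Real.cos θ], by
    rw [mem_sphere_zero_iff_norm, ← sq_eq_sq₀ (norm_nonneg _) zero_le_one,
      EuclideanSpace.norm_sq_eq]
    simp [Fin.sum_univ_three]
    nlinarith [Real.sin_sq_add_cos_sq θ, Real.sin_sq_add_cos_sq φ]⟩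

/-- The velocity at time `t` of a curve on `S²`. -/
def velocity (γ : ℝ → S2) (t : ℝ) : TangentSpace (𝓡 2) (γ t) :=
  mfderiv 𝓘(ℝ, ℝ) (𝓡 2) γ t (1 : ℝ)

/-- The momentum `p_θ`: the covector evaluated on the coordinate vector field `∂/∂θ`. -/
def pTheta (θ φ : ℝ) (p : Cotangent (sphericalPoint θ φ)) : ℝ :=
  p (velocity (fun t => sphericalPoint t φ) θ)

/-- The momentum `p_φ`: the covector evaluated on the coordinate vector field `∂/∂φ`. -/
def pPhi (θ φ : ℝ) (p : Cotangent (sphericalPoint θ φ)) : ℝ :=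
  p (velocity (fun t => sphericalPoint θ t) φ)

theorem inclusionDeriv_velocity (γ : ℝ → S2) (t : ℝ) (w : EuclideanSpace ℝ (Fin 3))
    (hs : ContDiff ℝ ∞ (fun u => (γ u : EuclideanSpace ℝ (Fin 3))))
    (h : HasDerivAt (fun u => (γ u : EuclideanSpace ℝ (Fin 3))) w t) :
    inclusionDeriv (γ t) (velocity γ t) = w := by
  have := finrank_three
  have hγ : ContMDiff 𝓘(ℝ, ℝ) (𝓡 2) ∞ γ :=
    ContMDiff.codRestrict_sphere (n := 2) hs.contMDiff (fun u => (γ u).2)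
  have h1 : MDifferentiableAt 𝓘(ℝ, ℝ) (𝓡 2) γ t := (hγ t).mdifferentiableAt (by simp)
  have h2 : MDifferentiableAt (𝓡 2) 𝓘(ℝ, EuclideanSpace ℝ (Fin 3))
      ((↑) : S2 → EuclideanSpace ℝ (Fin 3)) (γ t) :=
    ((contMDiff_coe_sphere (n := 2) (m := ∞)) (γ t)).mdifferentiableAt (by simp)
  have h3 := mfderiv_comp_apply t h2 h1 (1 : ℝ)
  have h4 : mfderiv 𝓘(ℝ, ℝ) 𝓘(ℝ, EuclideanSpace ℝ (Fin 3))
      ((↑) ∘ γ : ℝ → EuclideanSpace ℝ (Fin 3)) t (1 : ℝ) = w := by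
    rw [mfderiv_eq_fderiv]
    have h5 : fderiv ℝ ((↑) ∘ γ : ℝ → EuclideanSpace ℝ (Fin 3)) t = _ := h.hasFDerivAt.fderiv
    rw [h5]
    exact one_smul ℝ w
  exact h3.symm.trans h4

theorem hasDerivAt_euclidean_of_coord {f : ℝ → EuclideanSpace ℝ (Fin 3)}
    {w : EuclideanSpace ℝ (Fin 3)} {t : ℝ} (h : ∀ i, HasDerivAt (fun u => f u i) (w i) t) :
    HasDerivAt f w t := by
  rw [hasDerivAt_iff_hasFDerivAt, ← hasFDerivWithinAt_univ, hasFDerivWithinAt_euclidean]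
  intro i
  rw [hasFDerivWithinAt_univ]
  refine (h i).hasFDerivAt.congr_fderiv ?_
  ext
  simp

theorem inclusionDeriv_velocity_theta (θ φ : ℝ) :
    inclusionDeriv (sphericalPoint θ φ) (velocity (fun t => sphericalPoint t φ) θ) =
      !₂[-(Real.cos θ * Real.cos φ), -(Real.cos θ * Real.sin φ), -Real.sin θ] := by
  refine inclusionDeriv_velocity (fun t => sphericalPoint t φ) θ _ ?_ ?_
  · rw [contDiff_euclidean]
    intro i; fin_cases i <;> simp [sphericalPoint] <;> fun_prop
  · refine hasDerivAt_euclidean_of_coord fun i => ?_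
    fin_cases i <;> simp [sphericalPoint]
    · exact ((Real.hasDerivAt_sin θ).mul_const _).neg
    · exact ((Real.hasDerivAt_sin θ).mul_const _).neg
    · exact Real.hasDerivAt_cos θ

theorem inclusionDeriv_velocity_phi (θ φ : ℝ) :
    inclusionDeriv (sphericalPoint θ φ) (velocity (fun t => sphericalPoint θ t) φ) =
      !₂[Real.sin θ * Real.sin φ, -(Real.sin θ * Real.cos φ), 0] := by
  refine inclusionDeriv_velocity (fun t => sphericalPoint θ t) φ _ ?_ ?_
  · rw [contDiff_euclidean]
    intro i; fin_cases i <;> simp [sphericalPoint] <;> fun_prop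
  · refine hasDerivAt_euclidean_of_coord fun i => ?_
    fin_cases i <;> simp [sphericalPoint]
    · exact ((Real.hasDerivAt_cos φ).const_mul (Real.sin θ)).neg.congr_deriv (by ring)
    · exact ((Real.hasDerivAt_sin φ).const_mul _).neg
    · exact hasDerivAt_const _ _

/-- A tangent vector is determined by its components along `∂/∂θ` and `∂/∂φ`. -/
theorem covector_apply_tangentVector (θ φ a b : ℝ) (w : EuclideanSpace ℝ (Fin 3))
    (p : Cotangent (sphericalPoint θ φ))
    (h0 : w 0 = -a * (Real.cos θ * Real.cos φ) + b * (Real.sin θ * Real.sin φ))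
    (h1 : w 1 = -a * (Real.cos θ * Real.sin φ) - b * (Real.sin θ * Real.cos φ))
    (h2 : w 2 = -a * Real.sin θ) :
    p (tangentVector (sphericalPoint θ φ) w) = a * pTheta θ φ p + b * pPhi θ φ p := by
  have key : inclusionDeriv (sphericalPoint θ φ)
      (a • velocity (fun t => sphericalPoint t φ) θ
        + b • velocity (fun t => sphericalPoint θ t) φ) = w := by
    rw [map_add, map_smul, map_smul]
    erw [inclusionDeriv_velocity_theta, inclusionDeriv_velocity_phi]
    ext i
    fin_cases i
    · simp [h0]
    · simp [h1]; ring
    · simp [h2]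
  have hv : tangentVector (sphericalPoint θ φ) w =
      a • velocity (fun t => sphericalPoint t φ) θ
        + b • velocity (fun t => sphericalPoint θ t) φ := by
    rw [← key]
    exact Function.leftInverse_invFun (inclusionDeriv_injective _) _
  rw [hv, map_add, map_smul, map_smul]
  rfl

theorem Lx_sphericalPoint (θ φ : ℝ) (hθ : Real.sin θ ≠ 0) (p : Cotangent (sphericalPoint θ φ)) :
    Lx (sphericalPoint θ φ) p =
      Real.sin φ * pTheta θ φ p + Real.cos θ * Real.cos φ / Real.sin θ * pPhi θ φ p := by
  have := Real.sin_sq_add_cos_sq φ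
  refine covector_apply_tangentVector θ φ _ _ _ p ?_ ?_ ?_ <;>
    simp [sphericalPoint, yc, zc] <;> field_simp <;> grind

theorem Ly_sphericalPoint (θ φ : ℝ) (hθ : Real.sin θ ≠ 0) (p : Cotangent (sphericalPoint θ φ)) :
    Ly (sphericalPoint θ φ) p =
      -Real.cos φ * pTheta θ φ p + Real.cos θ * Real.sin φ / Real.sin θ * pPhi θ φ p := by
  have := Real.sin_sq_add_cos_sq φ
  refine covector_apply_tangentVector θ φ _ _ _ p ?_ ?_ ?_ <;>
    simp [sphericalPoint, xc, zc] <;> field_simp <;> grind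

theorem Lz_sphericalPoint (θ φ : ℝ) (p : Cotangent (sphericalPoint θ φ)) :
    Lz (sphericalPoint θ φ) p = pPhi θ φ p := by
  have h := covector_apply_tangentVector θ φ 0 1
    !₂[-yc (sphericalPoint θ φ), xc (sphericalPoint θ φ), 0] p
  simpa [sphericalPoint, xc, yc, Lz] using h

theorem K_sphericalPoint (s θ φ : ℝ) (hθ : Real.sin θ ≠ 0)
    (p : Cotangent (sphericalPoint θ φ)) :
    K s (sphericalPoint θ φ) p =
      (1 / 2) * (1 / Real.sin θ ^ 2 + G s (Real.cos θ)) * pPhi θ φ p ^ 2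
        + (1 / 2) * pTheta θ φ p ^ 2 := by
  have hz : zc (sphericalPoint θ φ) = Real.cos θ := by simp [sphericalPoint, zc]
  have h1 := Real.sin_sq_add_cos_sq φ
  have h2 := Real.sin_sq_add_cos_sq θ
  rw [K, Lx_sphericalPoint θ φ hθ, Ly_sphericalPoint θ φ hθ, Lz_sphericalPoint, hz]
  generalize G s (Real.cos θ) = g
  field_simp
  grind

theorem K₁_sphericalPoint (θ φ : ℝ) (hθ : Real.sin θ ≠ 0)
    (p : Cotangent (sphericalPoint θ φ)) :
    K₁ (sphericalPoint θ φ) p =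
      (1 / 2) * (Real.cos θ ^ 2 / Real.sin θ ^ 2 + 4) * pPhi θ φ p ^ 2
        + (1 / 2) * pTheta θ φ p ^ 2 := by
  have h1 := Real.sin_sq_add_cos_sq φ
  rw [K₁, Lx_sphericalPoint θ φ hθ, Ly_sphericalPoint θ φ hθ, Lz_sphericalPoint]
  field_simp
  grind

theorem V_sphericalPoint (s A c θ φ : ℝ) :
    V s A c (sphericalPoint θ φ) =
      A * (Real.sin θ / Real.sqrt (W s (Real.cos θ))) * Real.cos φ + c / W s (Real.cos θ) := by
  simp [V, sphericalPoint, xc, zc]; ring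

theorem V₁_sphericalPoint (A₁ θ φ : ℝ) :
    V₁ A₁ (sphericalPoint θ φ) = A₁ * Real.sin θ * Real.sin φ := by
  simp [V₁, sphericalPoint, yc]; ring

end

end SphereSystem

/-! The obstruction is metric. Up to the factor 1/2, `K` is the inverse metric `∂θ² + k(θ) ∂φ²` with
`k = 1 / sin² θ + G`, and `K₁` is `∂θ² + h(θ) ∂φ²` with `h = 1 / sin² θ + 3`. If `D` matched them up
to a constant `α`, it would carry the Killing field `∂φ` of the first metric to a Killing field of
the second.

The second metric has, locally, no Killing fields but the constant multiples of `∂φ`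
(`killing_box`). In coordinates `D = (T, F)` this means that `∂φ T = 0` and that `∂φ F = β` is
constant (`eventually_image_constant`). Then `T = μ θ + c` with `μ² = α`, `∂θ F = 0`, and what
remains is `β² k(θ) = α h(μ θ + c)` near one point.

By analyticity this persists for all `θ` once denominators are cleared. Comparing zeros of the sines
forces `μ = ±1` and `c ∈ π ℤ`; three values of `θ` then contradict `s > 1`
(`not_affine_equivalent`).

The argument is local, so one point where both coordinate systems are regular suffices
(`exists_good_point`). The statement on `H` follows because the kinetic parts vanish on zero
covectors, so the potentials can be subtracted. -/

namespace SphereSystem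

open Set Filter Topology

/-! ### Killing fields of the Goryachev–Chaplygin metric -/

/-- The ratio that a Killing field of `dθ² + dφ² / (1 / sin² θ + 3)` with nonzero `θ`-component
would force to be constant is not constant on any interval. -/
theorem killing_ratio_not_constant {κ t₀ r : ℝ} (hr : 0 < r)
    (h : ∀ t ∈ Ioo (t₀ - r) (t₀ + r),
      1 + 9 * Real.sin t ^ 2 - 6 * Real.sin t ^ 4 = κ * (1 + 3 * Real.sin t ^ 2) ^ 3) : False := by
  have hf : AnalyticOnNhd ℝ (fun t => 1 + 9 * Real.sin t ^ 2 - 6 * Real.sin t ^ 4) univ :=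
    fun t _ => by fun_prop
  have hg : AnalyticOnNhd ℝ (fun t => κ * (1 + 3 * Real.sin t ^ 2) ^ 3) univ :=
    fun t _ => by fun_prop
  -- The identity extends to all `t`: `t = 0` gives `κ = 1`, while `t = π / 2` gives `4 = 64 κ`.
  have he := hf.eq_of_eventuallyEq hg (z₀ := t₀)
    (eventually_of_mem (Ioo_mem_nhds (by linarith) (by linarith)) h)
  have h0 := congrFun he 0
  have h1 := congrFun he (Real.pi / 2)
  simp at h0 h1
  rw [← h0] at h1
  norm_num at h1

/-- A primitive of `h`, used to integrate the Killing equation `∂θ b = -h ∂φ a`. -/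
theorem hasDerivAt_three_mul_sub_cot {t : ℝ} (ht : Real.sin t ≠ 0) :
    HasDerivAt (fun t => 3 * t - Real.cos t / Real.sin t) (1 / Real.sin t ^ 2 + 3) t := by
  have h := ((hasDerivAt_id t).const_mul 3).sub
    ((Real.hasDerivAt_cos t).div (Real.hasDerivAt_sin t) ht)
  refine h.congr_deriv ?_
  have := Real.sin_sq_add_cos_sq t
  field_simp
  linarith

/-- The function differentiated is `h' / (2 h)`, the coefficient in the Killing equation `∂φ b = a
h' / (2 h)`. -/
theorem hasDerivAt_logDeriv {t : ℝ} (ht : Real.sin t ≠ 0) :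
    HasDerivAt (fun t => -(Real.cos t / (Real.sin t * (1 + 3 * Real.sin t ^ 2))))
      ((1 + 9 * Real.sin t ^ 2 - 6 * Real.sin t ^ 4) /
        (Real.sin t * (1 + 3 * Real.sin t ^ 2)) ^ 2) t := by
  have h1 : Real.sin t * (1 + 3 * Real.sin t ^ 2) ≠ 0 := mul_ne_zero ht (by positivity)
  have h := ((Real.hasDerivAt_cos t).div ((Real.hasDerivAt_sin t).mul
    ((((Real.hasDerivAt_sin t).pow 2).const_mul 3).const_add 1)) h1).neg
  refine h.congr_deriv ?_
  have h2 := Real.cos_sq' t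
  rw [← neg_div]
  congr 1
  simp only [Pi.pow_apply, Pi.mul_apply]
  push_cast
  ring_nf
  simp only [h2]
  ring

theorem constant_of_hasDerivAt_zero {f : ℝ → ℝ} {c r : ℝ}
    (h : ∀ t ∈ Ioo (c - r) (c + r), HasDerivAt f 0 t) {t : ℝ} (ht : t ∈ Ioo (c - r) (c + r)) :
    f t = f c := by
  have hc : c ∈ Ioo (c - r) (c + r) := by constructor <;> linarith [ht.1, ht.2]
  refine (convex_Ioo (c - r) (c + r)).is_const_of_fderivWithin_eq_zero (𝕜 := ℝ)
    (fun x hx => (h x hx).differentiableAt.differentiableWithinAt) (fun x hx => ?_) ht hc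
  rw [fderivWithin_of_isOpen isOpen_Ioo hx]
  ext
  simp [(h x hx).deriv]

/-- A Killing field `a ∂θ + b ∂φ` of the metric `dθ² + dφ² / (1 / sin² θ + 3)` on a coordinate
box is a constant multiple of `∂φ`. -/
theorem killing_box {a b a' : ℝ → ℝ → ℝ} {t₀ f₀ r : ℝ} (hr : 0 < r)
    (hsin : ∀ t ∈ Ioo (t₀ - r) (t₀ + r), Real.sin t ≠ 0)
    (hat : ∀ t ∈ Ioo (t₀ - r) (t₀ + r), ∀ f ∈ Ioo (f₀ - r) (f₀ + r),
      HasDerivAt (fun u => a u f) 0 t)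
    (haf : ∀ t ∈ Ioo (t₀ - r) (t₀ + r), ∀ f ∈ Ioo (f₀ - r) (f₀ + r),
      HasDerivAt (a t) (a' t f) f)
    (hbt : ∀ t ∈ Ioo (t₀ - r) (t₀ + r), ∀ f ∈ Ioo (f₀ - r) (f₀ + r),
      HasDerivAt (fun u => b u f) (-((1 / Real.sin t ^ 2 + 3) * a' t f)) t)
    (hbf : ∀ t ∈ Ioo (t₀ - r) (t₀ + r), ∀ f ∈ Ioo (f₀ - r) (f₀ + r),
      HasDerivAt (b t)
        (a t f * -(Real.cos t / (Real.sin t * (1 + 3 * Real.sin t ^ 2)))) f) :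
    ∀ t ∈ Ioo (t₀ - r) (t₀ + r), ∀ f ∈ Ioo (f₀ - r) (f₀ + r), a t f = 0 ∧ b t f = b t₀ f₀ := by
  have ht₀ : t₀ ∈ Ioo (t₀ - r) (t₀ + r) := by constructor <;> linarith
  have hf₀ : f₀ ∈ Ioo (f₀ - r) (f₀ + r) := by constructor <;> linarith
  set H : ℝ → ℝ := fun t => 3 * t - Real.cos t / Real.sin t with hH
  set q : ℝ → ℝ := fun t => -(Real.cos t / (Real.sin t * (1 + 3 * Real.sin t ^ 2))) with hq
  have ha : ∀ t ∈ Ioo (t₀ - r) (t₀ + r), ∀ f ∈ Ioo (f₀ - r) (f₀ + r), a t f = a t₀ f :=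
    fun t ht f hf => constant_of_hasDerivAt_zero (fun u hu => hat u hu f hf) ht
  have ha' : ∀ t ∈ Ioo (t₀ - r) (t₀ + r), ∀ f ∈ Ioo (f₀ - r) (f₀ + r), a' t f = a' t₀ f := by
    intro t ht f hf
    refine (haf t ht f hf).unique ((haf t₀ ht₀ f hf).congr_of_eventuallyEq ?_)
    exact eventually_of_mem (Ioo_mem_nhds hf.1 hf.2) fun g hg => ha t ht g hg
  have hb : ∀ t ∈ Ioo (t₀ - r) (t₀ + r), ∀ f ∈ Ioo (f₀ - r) (f₀ + r),
      b t f - b t₀ f = -((H t - H t₀) * a' t₀ f) := by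
    intro t ht f hf
    have := constant_of_hasDerivAt_zero (f := fun u => b u f + H u * a' t₀ f) (c := t₀) (r := r)
      (fun u hu => (((hbt u hu f hf).add
        ((hasDerivAt_three_mul_sub_cot (hsin u hu)).mul_const (a' t₀ f)))).congr_deriv (by
          rw [ha' u hu f hf]; ring)) ht
    linarith
  have hzero : ∀ f ∈ Ioo (f₀ - r) (f₀ + r), a t₀ f = 0 := by
    intro f hf
    by_contra hne
    have hHmono : ∀ t ∈ Ioo (t₀ - r) (t₀ + r), t ≠ t₀ → H t - H t₀ ≠ 0 := by
      intro t ht htn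
      have hm : StrictMonoOn H (Ioo (t₀ - r) (t₀ + r)) := by
        refine strictMonoOn_of_deriv_pos (convex_Ioo _ _)
          (fun u hu => (hasDerivAt_three_mul_sub_cot (hsin u hu)).continuousAt.continuousWithinAt) ?_
        rw [interior_Ioo]
        intro u hu
        rw [(hasDerivAt_three_mul_sub_cot (hsin u hu)).deriv]
        positivity
      intro h0
      exact htn (hm.injOn ht ht₀ (by linarith))
    -- Solving `hb` for `a' t₀` expresses it through `b`, which is differentiable in `f`. So the
    -- second derivative of `a` exists, and each `t ≠ t₀` gives a formula for it.
    have hA : ∀ t ∈ Ioo (t₀ - r) (t₀ + r), t ≠ t₀ →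
        HasDerivAt (a' t₀) (-(a t₀ f * (q t - q t₀) / (H t - H t₀))) f := by
      intro t ht htn
      have hd := (((hbf t ht f hf).sub (hbf t₀ ht₀ f hf)).div_const (H t - H t₀)).neg
      rw [ha t ht f hf, ← mul_sub] at hd
      refine hd.congr_of_eventuallyEq ?_
      filter_upwards [Ioo_mem_nhds hf.1 hf.2] with g hg
      have := hb t ht g hg
      have hn := hHmono t ht htn
      simp only [Pi.neg_apply, Pi.sub_apply]
      rw [this]
      field_simp
    -- That second derivative does not depend on `t`, and `a t₀ f ≠ 0` cancels, so the quotient of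
    -- increments of `q` and `H` is constant; `t₀ + r / 2` is merely a reference point.
    have hprop : ∃ κ, ∀ t ∈ Ioo (t₀ - r) (t₀ + r), q t - q t₀ = κ * (H t - H t₀) := by
      have ht₁ : t₀ + r / 2 ∈ Ioo (t₀ - r) (t₀ + r) := by constructor <;> linarith
      have hn₁ : t₀ + r / 2 ≠ t₀ := by linarith
      refine ⟨(q (t₀ + r / 2) - q t₀) / (H (t₀ + r / 2) - H t₀), fun t ht => ?_⟩
      by_cases htn : t = t₀
      · simp [htn]
      have := (hA t ht htn).unique (hA _ ht₁ hn₁)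
      have e1 := hHmono t ht htn
      have e2 := hHmono _ ht₁ hn₁
      rw [neg_inj, mul_div_assoc, mul_div_assoc, mul_right_inj' hne] at this
      rw [← this]
      field_simp
    obtain ⟨κ, hκ⟩ := hprop
    -- Differentiating in `t` gives `q' = κ h`.
    refine killing_ratio_not_constant (κ := κ) (t₀ := t₀) hr fun t ht => ?_
    have hs := hsin t ht
    have h1 := (hasDerivAt_logDeriv hs).sub_const (q t₀)
    have h2 := ((hasDerivAt_three_mul_sub_cot hs).sub_const (H t₀)).const_mul κ
    have h3 := h1.unique (h2.congr_of_eventuallyEq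
      (eventually_of_mem (Ioo_mem_nhds ht.1 ht.2) hκ))
    have hp : (1 + 3 * Real.sin t ^ 2) ≠ 0 := by positivity
    field_simp at h3
    linear_combination h3
  have ha'0 : ∀ f ∈ Ioo (f₀ - r) (f₀ + r), a' t₀ f = 0 := by
    intro f hf
    refine (haf t₀ ht₀ f hf).unique ((hasDerivAt_const f (0 : ℝ)).congr_of_eventuallyEq ?_)
    exact eventually_of_mem (Ioo_mem_nhds hf.1 hf.2) hzero
  intro t ht f hf
  refine ⟨(ha t ht f hf).trans (hzero f hf), ?_⟩
  have h1 := hb t ht f hf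
  rw [ha'0 f hf] at h1
  have h2 := constant_of_hasDerivAt_zero (f := b t₀)
    (fun g hg => (hbf t₀ ht₀ g hg).congr_deriv (by rw [hzero g hg, zero_mul])) hf
  linarith

/-! ### Comparison of the circumference functions -/

/-- The circumference functions of the two metrics do not correspond under an affine change of
the meridian parameter. -/
theorem not_affine_equivalent {s α β μ c θ₀ : ℝ} (hs : 1 < s) (hμ : μ ≠ 0) (hα : α = μ ^ 2)
    (h : ∀ᶠ θ in 𝓝 θ₀, Real.sin θ ≠ 0 ∧ Real.sin (μ * θ + c) ≠ 0 ∧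
      β ^ 2 * (1 / Real.sin θ ^ 2 + G s (Real.cos θ)) =
        α * (1 / Real.sin (μ * θ + c) ^ 2 + 3)) : False := by
  have hW : ∀ θ, W s (Real.cos θ) ≠ 0 := fun θ => by
    have := Real.neg_one_le_cos θ
    rw [W]; linarith
  have hα0 : α ≠ 0 := by rw [hα]; positivity
  -- With denominators cleared, both sides are analytic on the whole line, including the zeros of
  -- the sines, where the next steps evaluate them.
  have hf : AnalyticOnNhd ℝ (fun θ => β ^ 2 * ((2 * W s (Real.cos θ)) ^ 2 +
      P s (Real.cos θ) * Real.sin θ ^ 2) * Real.sin (μ * θ + c) ^ 2) univ :=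
    fun t _ => by unfold W P; fun_prop
  have hg : AnalyticOnNhd ℝ (fun θ => α * (1 + 3 * Real.sin (μ * θ + c) ^ 2) *
      Real.sin θ ^ 2 * (2 * W s (Real.cos θ)) ^ 2) univ :=
    fun t _ => by unfold W; fun_prop
  have he := congrFun (hf.eq_of_eventuallyEq hg (z₀ := θ₀) (by
    filter_upwards [h] with θ hθ
    obtain ⟨h1, h2, h3⟩ := hθ
    have := hW θ
    rw [G] at h3
    field_simp at h3
    linear_combination h3))
  have hβ : β ≠ 0 := by
    rintro rfl
    obtain ⟨h1, h2, h3⟩ := h.self_of_nhds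
    have : α * (1 / Real.sin (μ * θ₀ + c) ^ 2 + 3) ≠ 0 := mul_ne_zero hα0 (by positivity)
    apply this
    rw [← h3]; ring
  have z1 : ∀ θ, Real.sin θ = 0 → Real.sin (μ * θ + c) = 0 := by
    intro θ hθ
    have := he θ
    have hw := hW θ
    simp [hθ, hβ, hw] at this
    exact this
  have z2 : ∀ θ, Real.sin (μ * θ + c) = 0 → Real.sin θ = 0 := by
    intro θ hθ
    have := he θ
    have hw := hW θ
    simp [hθ, hα0, hw] at this
    exact this
  -- The two sines have the same zeros. The zeros `0` and `π` of `sin θ` make `c / π` and `μ`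
  -- integers; the zero `π / μ` of the other sine makes `1 / μ` an integer.
  obtain ⟨n, hn⟩ := Real.sin_eq_zero_iff.1 (z1 0 Real.sin_zero)
  rw [mul_zero, zero_add] at hn
  have hpi := Real.pi_pos
  obtain ⟨m, hm⟩ := Real.sin_eq_zero_iff.1 (z1 Real.pi Real.sin_pi)
  have hμm : μ = ((m - n : ℤ) : ℝ) := by
    push_cast
    have : (μ - (m - n)) * Real.pi = 0 := by linear_combination hn - hm
    have := (mul_eq_zero.1 this).resolve_right hpi.ne'
    linarith
  obtain ⟨l, hl⟩ := Real.sin_eq_zero_iff.1 (z2 (Real.pi / μ) (by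
    rw [mul_div_cancel₀ _ hμ, add_comm, Real.sin_add_pi, ← hn, Real.sin_int_mul_pi, neg_zero]))
  have hlm : l * (m - n) = 1 := by
    have : (l : ℝ) * ((m - n : ℤ) : ℝ) = 1 := by
      rw [← hμm]
      field_simp at hl
      linarith
    exact_mod_cast this
  have hμ2 : μ ^ 2 = 1 := by
    rcases Int.eq_one_or_neg_one_of_mul_eq_one' hlm with h | h <;> rw [hμm, h.2] <;> norm_num
  have hsq : ∀ θ, Real.sin (μ * θ + c) ^ 2 = Real.sin θ ^ 2 := by
    intro θ
    have h1 : Real.sin (μ * θ + c) ^ 2 = Real.sin (μ * θ) ^ 2 := by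
      rw [← hn, Real.sin_add_int_mul_pi, mul_pow]
      rw [← sq_abs, abs_zpow]; simp
    rw [h1]
    rcases sq_eq_sq_iff_eq_or_eq_neg.1 (hμ2.trans (one_pow 2).symm) with h | h <;> simp [h]
  have key : ∀ θ, Real.sin θ ≠ 0 → β ^ 2 * ((2 * W s (Real.cos θ)) ^ 2 +
      P s (Real.cos θ) * Real.sin θ ^ 2) =
      (1 + 3 * Real.sin θ ^ 2) * (2 * W s (Real.cos θ)) ^ 2 := by
    intro θ hθ
    have := he θ
    rw [hsq, hα, hμ2] at this
    apply mul_right_cancel₀ (pow_ne_zero 2 hθ)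
    linear_combination this
  have k1 := key (Real.pi / 2) (by simp)
  have k2 := key (Real.pi / 3) (by simp)
  have k3 := key (Real.pi - Real.pi / 3) (by simp)
  have h3 : Real.sqrt 3 ^ 2 = 3 := Real.sq_sqrt (by norm_num)
  rw [Real.sin_pi_sub, Real.cos_pi_sub] at k3
  simp only [Real.sin_pi_div_three, Real.cos_pi_div_three, Real.sin_pi_div_two,
    Real.cos_pi_div_two, W, P, div_pow, h3] at k1 k2 k3
  have hb : β ^ 2 = 26 / 11 := by
    -- `k2` and `k3` differ by the sign of the cosine, so their difference keeps only the terms odd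
    -- in `s`: `11 β² s = 26 s`. Then `k1` gives `s² = 13 / 36`.
    have : (β ^ 2 - 26 / 11) * s = 0 := by linear_combination (k2 - k3) / 11
    rcases mul_eq_zero.1 this with h | h <;> linarith
  rw [hb] at k1
  nlinarith

/-! ### The image of `∂φ` under a local equivalence -/

theorem hasFDerivAt_partial {f : ℝ × ℝ → ℝ} {O : Set (ℝ × ℝ)} (hO : IsOpen O)
    (hf : ContDiffOn ℝ ∞ f O) (v : ℝ × ℝ) {x : ℝ × ℝ} (hx : x ∈ O) :
    HasFDerivAt (fun y => fderiv ℝ f y v) ((fderiv ℝ (fderiv ℝ f) x).flip v) x := by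
  have h1 : ContDiffAt ℝ ∞ f x := hf.contDiffAt (hO.mem_nhds hx)
  have h2 : DifferentiableAt ℝ (fderiv ℝ f) x :=
    (h1.fderiv_right (m := 1) (by norm_cast)).differentiableAt (by simp)
  exact (h2.hasFDerivAt.clm_apply (hasFDerivAt_const v x)).congr_fderiv (by ext <;> simp)

theorem second_fderiv_comm {f : ℝ × ℝ → ℝ} {O : Set (ℝ × ℝ)} (hO : IsOpen O)
    (hf : ContDiffOn ℝ ∞ f O) (v w : ℝ × ℝ) {x : ℝ × ℝ} (hx : x ∈ O) :
    fderiv ℝ (fderiv ℝ f) x v w = fderiv ℝ (fderiv ℝ f) x w v :=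
  ((hf.contDiffAt (hO.mem_nhds hx)).isSymmSndFDerivAt
    (by simpa using WithTop.coe_le_coe.2 (le_top (a := (2 : ℕ∞))))).eq v w

theorem clm_prod_apply (L : ℝ × ℝ →L[ℝ] ℝ) (u v : ℝ) : L (u, v) = u * L (1, 0) + v * L (0, 1) := by
  have : ((u, v) : ℝ × ℝ) = u • (1, 0) + v • (0, 1) := by simp
  rw [this, map_add, map_smul, map_smul]
  rfl

/-- Derivative of a partial derivative in the second variable. -/
theorem hasDerivAt_partial_snd {f : ℝ × ℝ → ℝ} {O : Set (ℝ × ℝ)} (hO : IsOpen O)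
    (hf : ContDiffOn ℝ ∞ f O) (v : ℝ × ℝ) {x : ℝ × ℝ} (hx : x ∈ O) :
    HasDerivAt (fun t => fderiv ℝ f (x.1, t) v) (fderiv ℝ (fderiv ℝ f) x (0, 1) v) x.2 := by
  have h := (hasFDerivAt_partial hO hf v hx).comp_hasDerivAt (x := x.2)
    (f := fun t => (x.1, t)) ((hasDerivAt_const _ _).prodMk (hasDerivAt_id _))
  exact h.congr_deriv (by simp)

/-- The Killing equations for the image of `∂φ`, written in the source coordinates. -/
theorem killing_equations {α : ℝ} {k : ℝ → ℝ} {O : Set (ℝ × ℝ)} (hO : IsOpen O)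
    {T F : ℝ × ℝ → ℝ} (hT : ContDiffOn ℝ ∞ T O) (hF : ContDiffOn ℝ ∞ F O)
    (hsinT : ∀ x ∈ O, Real.sin (T x) ≠ 0)
    (e₁ : ∀ x ∈ O, fderiv ℝ T x (1, 0) ^ 2 + k x.1 * fderiv ℝ T x (0, 1) ^ 2 = α)
    (e₂ : ∀ x ∈ O, fderiv ℝ T x (1, 0) * fderiv ℝ F x (1, 0) +
      k x.1 * (fderiv ℝ T x (0, 1) * fderiv ℝ F x (0, 1)) = 0)
    (e₃ : ∀ x ∈ O, fderiv ℝ F x (1, 0) ^ 2 + k x.1 * fderiv ℝ F x (0, 1) ^ 2 =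
      α * (1 / Real.sin (T x) ^ 2 + 3)) :
    (∀ x ∈ O, fderiv ℝ T x (1, 0) * fderiv ℝ (fderiv ℝ T) x (1, 0) (0, 1) +
    k x.1 * fderiv ℝ T x (0, 1) * fderiv ℝ (fderiv ℝ T) x (0, 1) (0, 1) = 0) ∧
    (∀ x ∈ O,
    fderiv ℝ F x (1, 0) * fderiv ℝ (fderiv ℝ T) x (1, 0) (0, 1) +
    k x.1 * fderiv ℝ F x (0, 1) * fderiv ℝ (fderiv ℝ T) x (0, 1) (0, 1) +
    (fderiv ℝ T x (1, 0) * fderiv ℝ (fderiv ℝ F) x (1, 0) (0, 1) +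
    k x.1 * fderiv ℝ T x (0, 1) * fderiv ℝ (fderiv ℝ F) x (0, 1) (0, 1)) = 0) ∧
    (∀ x ∈ O, fderiv ℝ F x (1, 0) * fderiv ℝ (fderiv ℝ F) x (1, 0) (0, 1) +
    k x.1 * fderiv ℝ F x (0, 1) * fderiv ℝ (fderiv ℝ F) x (0, 1) (0, 1) =
    -(α * fderiv ℝ T x (0, 1) * (Real.cos (T x) / Real.sin (T x) ^ 3))) := by
  have hDT : ∀ x ∈ O, HasFDerivAt T (fderiv ℝ T x) x := fun x hx =>
    ((hT.contDiffAt (hO.mem_nhds hx)).differentiableAt (by simp)).hasFDerivAt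
  have hev : ∀ x ∈ O, ∀ᶠ t in 𝓝 x.2, (x.1, t) ∈ O := fun x hx =>
    (Continuous.prodMk_right x.1).continuousAt.eventually (hO.mem_nhds hx)
  -- Each equation is the `φ`-derivative of one of `e₁`, `e₂`, `e₃`; `k` depends on `θ` only, so it
  -- is not differentiated.
  refine ⟨?_, ?_, ?_⟩
  · intro x hx
    have := (((hasDerivAt_partial_snd hO hT (1, 0) hx).pow 2).add
      (((hasDerivAt_partial_snd hO hT (0, 1) hx).pow 2).const_mul (k x.1))).unique
      ((hasDerivAt_const x.2 α).congr_of_eventuallyEq ((hev x hx).mono fun t ht => e₁ _ ht))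
    rw [second_fderiv_comm hO hT (0, 1) (1, 0) hx] at this
    simp at this
    linear_combination this / 2
  · intro x hx
    have := (((hasDerivAt_partial_snd hO hT (1, 0) hx).mul
        (hasDerivAt_partial_snd hO hF (1, 0) hx)).add
      (((hasDerivAt_partial_snd hO hT (0, 1) hx).mul
        (hasDerivAt_partial_snd hO hF (0, 1) hx)).const_mul (k x.1))).unique
      ((hasDerivAt_const x.2 0).congr_of_eventuallyEq ((hev x hx).mono fun t ht => e₂ _ ht))
    rw [second_fderiv_comm hO hT (0, 1) (1, 0) hx,
      second_fderiv_comm hO hF (0, 1) (1, 0) hx] at this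
    linear_combination this
  · intro x hx
    have hTt : HasDerivAt (fun t => T (x.1, t)) (fderiv ℝ T x (0, 1)) x.2 :=
      ((hDT x hx).comp_hasDerivAt (x := x.2) (f := fun t => (x.1, t))
        ((hasDerivAt_const _ _).prodMk (hasDerivAt_id _))).congr_deriv (by simp)
    have hs0 := hsinT x hx
    have hr : HasDerivAt (fun t => α * (1 / Real.sin (T (x.1, t)) ^ 2 + 3))
        (α * -(2 * fderiv ℝ T x (0, 1) * (Real.cos (T x) / Real.sin (T x) ^ 3))) x.2 := by
      have h1 := (((hTt.sin.pow 2).inv (pow_ne_zero 2 hs0)).add_const 3).const_mul α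
      simp only [one_div]
      refine h1.congr_deriv ?_
      simp only [Pi.pow_apply]
      push_cast
      field_simp
    have := (((hasDerivAt_partial_snd hO hF (1, 0) hx).pow 2).add
      (((hasDerivAt_partial_snd hO hF (0, 1) hx).pow 2).const_mul (k x.1))).unique
      (hr.congr_of_eventuallyEq ((hev x hx).mono fun t ht => e₃ _ ht))
    rw [second_fderiv_comm hO hF (0, 1) (1, 0) hx] at this
    simp at this
    linear_combination this / 2

/-- Two orthogonal covectors of given lengths give a linear isomorphism with explicit inverse. -/
theorem exists_differential_equiv {A B : ℝ × ℝ →L[ℝ] ℝ} {k h α : ℝ} (hα : α ≠ 0) (hh : h ≠ 0)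
    (h₁ : A (1, 0) ^ 2 + k * A (0, 1) ^ 2 = α)
    (h₂ : A (1, 0) * B (1, 0) + k * (A (0, 1) * B (0, 1)) = 0)
    (h₃ : B (1, 0) ^ 2 + k * B (0, 1) ^ 2 = α * h) :
    ∃ L : (ℝ × ℝ) ≃L[ℝ] (ℝ × ℝ), (L : ℝ × ℝ →L[ℝ] ℝ × ℝ) = A.prod B ∧
      L.symm (1, 0) = (1 / α) • (A (1, 0), k * A (0, 1)) ∧
      L.symm (0, 1) = (1 / (α * h)) • (B (1, 0), k * B (0, 1)) := by
  -- If `J` has rows `A`, `B` and `g = diag(1, k)`, the hypotheses say `J g Jᵗ = α diag(1, h)`;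
  -- hence `J⁻¹ = g Jᵗ diag(1 / α, 1 / (α h))`.
  set M : ℝ × ℝ →L[ℝ] ℝ × ℝ :=
    (ContinuousLinearMap.fst ℝ ℝ ℝ).smulRight ((1 / α) • (A (1, 0), k * A (0, 1))) +
    (ContinuousLinearMap.snd ℝ ℝ ℝ).smulRight ((1 / (α * h)) • (B (1, 0), k * B (0, 1))) with hM
  have hr : ∀ p, A.prod B (M p) = p := by
    rintro ⟨p, q⟩
    have hMp : M (p, q) = p • (1 / α) • (A (1, 0), k * A (0, 1)) +
      q • (1 / (α * h)) • (B (1, 0), k * B (0, 1)) := rfl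
    rw [hMp, ContinuousLinearMap.prod_apply, map_add, map_add, map_smul, map_smul, map_smul,
      map_smul, map_smul, map_smul, map_smul, map_smul,
      clm_prod_apply A (A (1, 0)), clm_prod_apply A (B (1, 0)),
      clm_prod_apply B (A (1, 0)), clm_prod_apply B (B (1, 0))]
    simp only [smul_eq_mul, Prod.mk.injEq]
    constructor
    · field_simp
      linear_combination p * h * h₁ + q * h₂
    · field_simp
      linear_combination p * h * h₂ + q * h₃
  have hcomp : (A.prod B).toLinearMap ∘ₗ M.toLinearMap = LinearMap.id := LinearMap.ext hr
  have hl := LinearMap.congr_fun ((LinearMap.comp_eq_id_comm ℝ (ℝ × ℝ)).1 hcomp)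
  refine ⟨ContinuousLinearEquiv.equivOfInverse (A.prod B) M hl hr, rfl, ?_, ?_⟩
  · change M (1, 0) = _
    simp [hM]
  · change M (0, 1) = _
    simp [hM]

/-- A local map `(T, F)` which carries the inverse metric `∂θ² + k ∂φ²` to a constant multiple of
`∂θ² + (1 / sin² θ + 3) ∂φ²` sends `∂φ` to a constant multiple of `∂φ`. -/
theorem eventually_image_constant {α : ℝ} {k : ℝ → ℝ} (hα : α ≠ 0) {O : Set (ℝ × ℝ)} (hO : IsOpen O)
    {x₀ : ℝ × ℝ} (hx₀ : x₀ ∈ O) {T F : ℝ × ℝ → ℝ}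
    (hT : ContDiffOn ℝ ∞ T O) (hF : ContDiffOn ℝ ∞ F O)
    (hsinT : ∀ x ∈ O, Real.sin (T x) ≠ 0)
    (e₁ : ∀ x ∈ O, fderiv ℝ T x (1, 0) ^ 2 +
      k x.1 * fderiv ℝ T x (0, 1) ^ 2 = α)
    (e₂ : ∀ x ∈ O, fderiv ℝ T x (1, 0) * fderiv ℝ F x (1, 0) +
      k x.1 *
        (fderiv ℝ T x (0, 1) * fderiv ℝ F x (0, 1)) = 0)
    (e₃ : ∀ x ∈ O, fderiv ℝ F x (1, 0) ^ 2 +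
      k x.1 * fderiv ℝ F x (0, 1) ^ 2 =
        α * (1 / Real.sin (T x) ^ 2 + 3)) :
    ∀ᶠ x in 𝓝 x₀, x ∈ O ∧ fderiv ℝ T x (0, 1) = 0 ∧
      fderiv ℝ F x (0, 1) = fderiv ℝ F x₀ (0, 1) := by
  set h : ℝ → ℝ := fun t => 1 / Real.sin t ^ 2 + 3 with hh
  have hpos : ∀ t, h t ≠ 0 := fun t => by
    have : 0 < h t := by simp only [hh]; positivity
    exact this.ne'
  have hDT : ∀ x ∈ O, HasFDerivAt T (fderiv ℝ T x) x := fun x hx =>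
    ((hT.contDiffAt (hO.mem_nhds hx)).differentiableAt (by simp)).hasFDerivAt
  have hDF : ∀ x ∈ O, HasFDerivAt F (fderiv ℝ F x) x := fun x hx =>
    ((hF.contDiffAt (hO.mem_nhds hx)).differentiableAt (by simp)).hasFDerivAt
  obtain ⟨d₁, d₂, d₃⟩ : (∀ x ∈ O, _) ∧ (∀ x ∈ O, _) ∧ (∀ x ∈ O, _) :=
    killing_equations (α := α) (k := k) hO hT hF hsinT e₁ e₂ e₃
  -- the differential of `(T, F)` and its inverse
  have hequiv : ∀ x ∈ O, ∃ L : (ℝ × ℝ) ≃L[ℝ] (ℝ × ℝ),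
      (L : ℝ × ℝ →L[ℝ] ℝ × ℝ) = (fderiv ℝ T x).prod (fderiv ℝ F x) ∧
      L.symm (1, 0) = (1 / α) • (fderiv ℝ T x (1, 0), k x.1 * fderiv ℝ T x (0, 1)) ∧
      L.symm (0, 1) = (1 / (α * h (T x))) •
        (fderiv ℝ F x (1, 0), k x.1 * fderiv ℝ F x (0, 1)) := fun x hx =>
    exists_differential_equiv hα (hpos (T x)) (e₁ x hx) (e₂ x hx) (e₃ x hx)
  obtain ⟨L₀, hL₀, -⟩ := hequiv x₀ hx₀
  have hstrict : HasStrictFDerivAt (fun x => (T x, F x)) (L₀ : ℝ × ℝ →L[ℝ] ℝ × ℝ) x₀ := by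
    rw [hL₀]
    exact ((hT.contDiffAt (hO.mem_nhds hx₀)).hasStrictFDerivAt (by simp)).prodMk
      ((hF.contDiffAt (hO.mem_nhds hx₀)).hasStrictFDerivAt (by simp))
  set e := hstrict.toOpenPartialHomeomorph (fun x => (T x, F x)) with he
  have hecoe : ∀ x, e x = (T x, F x) := fun x => rfl
  have hxs : x₀ ∈ e.source := hstrict.mem_toOpenPartialHomeomorph_source
  have hU : IsOpen (e.target ∩ e.symm ⁻¹' O) := e.symm.isOpen_inter_preimage hO
  have hy₀ : (T x₀, F x₀) ∈ e.target ∩ e.symm ⁻¹' O :=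
    ⟨e.map_source hxs, by rw [mem_preimage, ← hecoe, e.left_inv hxs]; exact hx₀⟩
  obtain ⟨r, hr, hball⟩ := Metric.isOpen_iff.1 hU _ hy₀
  have hbox : ∀ t ∈ Ioo (T x₀ - r) (T x₀ + r), ∀ f ∈ Ioo (F x₀ - r) (F x₀ + r),
      (t, f) ∈ e.target ∩ e.symm ⁻¹' O := by
    intro t ht f hf
    refine hball ?_
    rw [← ball_prod_same, Real.ball_eq_Ioo, Real.ball_eq_Ioo]
    exact ⟨ht, hf⟩
  have hTF : ∀ y ∈ e.target, T (e.symm y) = y.1 ∧ F (e.symm y) = y.2 := by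
    intro y hy
    have := e.right_inv hy
    rw [hecoe] at this
    exact Prod.ext_iff.1 this
  -- The target coordinate fields, in source coordinates, are the rescaled gradients of `T` and `F`.
  -- Along them `d₁`, `d₂`, `d₃` become the Killing equations.
  have hinv : ∀ y ∈ e.target ∩ e.symm ⁻¹' O,
      HasDerivAt (fun u => e.symm (u, y.2)) ((1 / α) • (fderiv ℝ T (e.symm y) (1, 0),
        k (e.symm y).1 * fderiv ℝ T (e.symm y) (0, 1))) y.1 ∧
      HasDerivAt (fun u => e.symm (y.1, u)) ((1 / (α * h y.1)) • (fderiv ℝ F (e.symm y) (1, 0),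
        k (e.symm y).1 * fderiv ℝ F (e.symm y) (0, 1))) y.2 := by
    intro y hy
    obtain ⟨L, hL, hL1, hL2⟩ := hequiv _ hy.2
    have hd : HasFDerivAt e.symm (L.symm : ℝ × ℝ →L[ℝ] ℝ × ℝ) y := by
      refine e.hasFDerivAt_symm hy.1 ?_
      rw [hL]
      exact (hDT _ hy.2).prodMk (hDF _ hy.2)
    rw [(hTF y hy.1).1] at hL2
    refine ⟨?_, ?_⟩
    · rw [← hL1]
      exact hd.comp_hasDerivAt (x := y.1) (f := fun u => (u, y.2))
        ((hasDerivAt_id _).prodMk (hasDerivAt_const _ _))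
    · rw [← hL2]
      exact hd.comp_hasDerivAt (x := y.2) (f := fun u => (y.1, u))
        ((hasDerivAt_const _ _).prodMk (hasDerivAt_id _))
  have hpart : ∀ {f : ℝ × ℝ → ℝ}, ContDiffOn ℝ ∞ f O → ∀ y ∈ e.target ∩ e.symm ⁻¹' O,
      HasDerivAt (fun u => fderiv ℝ f (e.symm (u, y.2)) (0, 1))
        ((1 / α) * (fderiv ℝ T (e.symm y) (1, 0) *
            fderiv ℝ (fderiv ℝ f) (e.symm y) (1, 0) (0, 1) +
          k (e.symm y).1 * fderiv ℝ T (e.symm y) (0, 1) *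
            fderiv ℝ (fderiv ℝ f) (e.symm y) (0, 1) (0, 1))) y.1 ∧
      HasDerivAt (fun u => fderiv ℝ f (e.symm (y.1, u)) (0, 1))
        ((1 / (α * h y.1)) * (fderiv ℝ F (e.symm y) (1, 0) *
            fderiv ℝ (fderiv ℝ f) (e.symm y) (1, 0) (0, 1) +
          k (e.symm y).1 * fderiv ℝ F (e.symm y) (0, 1) *
            fderiv ℝ (fderiv ℝ f) (e.symm y) (0, 1) (0, 1))) y.2 := by
    intro f hf y hy
    have hd := hasFDerivAt_partial hO hf (0, 1) hy.2
    obtain ⟨h1, h2⟩ := hinv y hy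
    constructor
    · refine (hd.comp_hasDerivAt (x := y.1) (f := fun u => e.symm (u, y.2)) h1).congr_deriv ?_
      rw [map_smul, clm_prod_apply]
      rfl
    · refine (hd.comp_hasDerivAt (x := y.2) (f := fun u => e.symm (y.1, u)) h2).congr_deriv ?_
      rw [map_smul, clm_prod_apply]
      rfl
  -- `a` and `b` are the components of the image of `∂φ` in the target coordinates.
  have hkill := killing_box (t₀ := T x₀) (f₀ := F x₀) hr
    (a := fun t f => fderiv ℝ T (e.symm (t, f)) (0, 1))
    (b := fun t f => fderiv ℝ F (e.symm (t, f)) (0, 1))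
    (a' := fun t f => (1 / (α * h t)) * (fderiv ℝ F (e.symm (t, f)) (1, 0) *
            fderiv ℝ (fderiv ℝ T) (e.symm (t, f)) (1, 0) (0, 1) +
          k (e.symm (t, f)).1 * fderiv ℝ F (e.symm (t, f)) (0, 1) *
            fderiv ℝ (fderiv ℝ T) (e.symm (t, f)) (0, 1) (0, 1)))
    (by
      intro t ht
      have hy := hbox t ht (F x₀) ⟨by linarith, by linarith⟩
      have := hsinT _ hy.2
      rwa [(hTF _ hy.1).1] at this)
    (by
      intro t ht f hf
      have hy := hbox t ht f hf
      refine (hpart hT _ hy).1.congr_deriv ?_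
      rw [d₁ _ hy.2, mul_zero])
    (by
      intro t ht f hf
      exact (hpart hT _ (hbox t ht f hf)).2)
    (by
      intro t ht f hf
      have hy := hbox t ht f hf
      refine (hpart hF _ hy).1.congr_deriv ?_
      have := d₂ _ hy.2
      have hn := hpos t
      change _ = -(h t * _)
      field_simp
      linear_combination this)
    (by
      intro t ht f hf
      have hy := hbox t ht f hf
      refine (hpart hF _ hy).2.congr_deriv ?_
      have hst := hsinT _ hy.2
      rw [d₃ _ hy.2]
      rw [(hTF _ hy.1).1] at hst ⊢
      simp only [hh] at hst ⊢
      have : (1 + 3 * Real.sin t ^ 2) ≠ 0 := by positivity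
      field_simp)
  have hc : ContinuousAt (fun x => (T x, F x)) x₀ :=
    ((hDT _ hx₀).continuousAt).prodMk ((hDF _ hx₀).continuousAt)
  filter_upwards [hO.mem_nhds hx₀, e.open_source.mem_nhds hxs,
    hc.eventually (Metric.ball_mem_nhds _ hr)] with x hx hxe hxb
  replace hxb : (T x, F x) ∈ Metric.ball (T x₀, F x₀) r := hxb
  rw [← ball_prod_same, Real.ball_eq_Ioo, Real.ball_eq_Ioo] at hxb
  have := hkill _ hxb.1 _ hxb.2
  have hl : e.symm (T x, F x) = x := e.left_inv hxe
  have hl₀ : e.symm (T x₀, F x₀) = x₀ := e.left_inv hxs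
  simp only [hl, hl₀] at this
  exact ⟨hx, this⟩

/-! ### Local inequivalence of the metrics -/

/-- There is no local diffeomorphism `(T, F)` of coordinate domains which carries the inverse
metric `∂θ² + (1 / sin² θ + G) ∂φ²` to a constant multiple of `∂θ² + (1 / sin² θ + 3) ∂φ²`. -/
theorem no_local_equivalence {s α : ℝ} (hs : 1 < s) (hα : α ≠ 0) {O : Set (ℝ × ℝ)} (hO : IsOpen O)
    {x₀ : ℝ × ℝ} (hx₀ : x₀ ∈ O) {T F : ℝ × ℝ → ℝ}
    (hT : ContDiffOn ℝ ∞ T O) (hF : ContDiffOn ℝ ∞ F O)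
    (hsin : ∀ x ∈ O, Real.sin x.1 ≠ 0) (hsinT : ∀ x ∈ O, Real.sin (T x) ≠ 0)
    (e₁ : ∀ x ∈ O, fderiv ℝ T x (1, 0) ^ 2 +
      (1 / Real.sin x.1 ^ 2 + G s (Real.cos x.1)) * fderiv ℝ T x (0, 1) ^ 2 = α)
    (e₂ : ∀ x ∈ O, fderiv ℝ T x (1, 0) * fderiv ℝ F x (1, 0) +
      (1 / Real.sin x.1 ^ 2 + G s (Real.cos x.1)) *
        (fderiv ℝ T x (0, 1) * fderiv ℝ F x (0, 1)) = 0)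
    (e₃ : ∀ x ∈ O, fderiv ℝ F x (1, 0) ^ 2 +
      (1 / Real.sin x.1 ^ 2 + G s (Real.cos x.1)) * fderiv ℝ F x (0, 1) ^ 2 =
        α * (1 / Real.sin (T x) ^ 2 + 3)) : False := by
  set k : ℝ → ℝ := fun θ => 1 / Real.sin θ ^ 2 + G s (Real.cos θ) with hk
  have hDT : ∀ x ∈ O, HasFDerivAt T (fderiv ℝ T x) x := fun x hx =>
    ((hT.contDiffAt (hO.mem_nhds hx)).differentiableAt (by simp)).hasFDerivAt
  have hnear := eventually_image_constant (α := α) (k := k) hα hO hx₀ hT hF hsinT e₁ e₂ e₃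
  set μ := fderiv ℝ T x₀ (1, 0) with hμ
  set β := fderiv ℝ F x₀ (0, 1) with hβ
  have hsq : ∀ x ∈ O, fderiv ℝ T x (0, 1) = 0 → fderiv ℝ T x (1, 0) ^ 2 = α := by
    intro x hx h0
    have := e₁ x hx
    rw [h0] at this
    linarith
  have hα2 : α = μ ^ 2 := (hsq x₀ hx₀ hnear.self_of_nhds.2.1).symm
  have hμ0 : μ ≠ 0 := by
    intro h0
    rw [h0] at hα2
    exact hα (by simpa using hα2)
  have hnear2 : ∀ᶠ x in 𝓝 x₀, fderiv ℝ T x (1, 0) = μ := by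
    -- Only `∂θ T = ±μ` is known. The sum `∂θ T + μ` equals `2 μ ≠ 0` at `x₀`, so by continuity the
    -- sign `-` is excluded nearby.
    have hc : ContinuousAt (fun x => fderiv ℝ T x (1, 0) + μ) x₀ :=
      (hasFDerivAt_partial hO hT (1, 0) hx₀).continuousAt.add continuousAt_const
    filter_upwards [hnear, hc.eventually_ne (y := 0)
      (by rw [← hμ, ← two_mul]; exact mul_ne_zero two_ne_zero hμ0)] with x hx hne
    have := hsq x hx.1 hx.2.1
    rw [hα2] at this
    rcases sq_eq_sq_iff_eq_or_eq_neg.1 this with h | h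
    · exact h
    · exact absurd (by rw [h]; ring) hne
  have hline : ∀ᶠ θ in 𝓝 x₀.1, ((θ, x₀.2) ∈ O ∧ fderiv ℝ T (θ, x₀.2) (0, 1) = 0 ∧
      fderiv ℝ F (θ, x₀.2) (0, 1) = β) ∧ fderiv ℝ T (θ, x₀.2) (1, 0) = μ :=
    (Continuous.prodMk_left x₀.2).continuousAt.eventually (hnear.and hnear2)
  obtain ⟨δ, hδ, hI⟩ := Metric.eventually_nhds_iff_ball.1 hline
  rw [Real.ball_eq_Ioo] at hI
  have haff : ∀ θ ∈ Ioo (x₀.1 - δ) (x₀.1 + δ), T (θ, x₀.2) = μ * θ + (T x₀ - μ * x₀.1) := by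
    intro θ hθ
    have := constant_of_hasDerivAt_zero (f := fun θ => T (θ, x₀.2) - μ * θ) (c := x₀.1) (r := δ)
      (fun u hu => by
        have h1 : HasDerivAt (fun θ => T (θ, x₀.2)) μ u := by
          rw [← (hI u hu).2]
          exact (hDT _ (hI u hu).1.1).comp_hasDerivAt (x := u) (f := fun θ => (θ, x₀.2))
            ((hasDerivAt_id' u).prodMk (hasDerivAt_const u x₀.2))
        have h2 : HasDerivAt (fun θ => μ * θ) μ u := by
          simpa using (hasDerivAt_id' u).const_mul μ
        simpa using h1.fun_sub h2) hθ
    simp only [Prod.mk.eta] at this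
    linarith
  have hcirc : ∀ᶠ θ in 𝓝 x₀.1, Real.sin θ ≠ 0 ∧
      Real.sin (μ * θ + (T x₀ - μ * x₀.1)) ≠ 0 ∧
      β ^ 2 * (1 / Real.sin θ ^ 2 + G s (Real.cos θ)) =
        α * (1 / Real.sin (μ * θ + (T x₀ - μ * x₀.1)) ^ 2 + 3) := by
    filter_upwards [Ioo_mem_nhds (sub_lt_self x₀.1 hδ) (lt_add_of_pos_right x₀.1 hδ)] with θ hθ
    obtain ⟨⟨hO', h0, hb⟩, hm⟩ := hI θ hθ
    rw [← haff θ hθ]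
    refine ⟨hsin (θ, x₀.2) hO', hsinT (θ, x₀.2) hO', ?_⟩
    have h2 := e₂ _ hO'
    have h3 := e₃ _ hO'
    rw [h0, hm] at h2
    have hF1 : fderiv ℝ F (θ, x₀.2) (1, 0) = 0 := by
      have : μ * fderiv ℝ F (θ, x₀.2) (1, 0) = 0 := by linear_combination h2
      exact (mul_eq_zero.1 this).resolve_left hμ0
    rw [hF1, hb] at h3
    linear_combination h3
  exact not_affine_equivalent hs hμ0 hα2 hcirc

/-! ### Spherical coordinates on the sphere -/

theorem coord_sq_sum (q : S2) : xc q ^ 2 + yc q ^ 2 + zc q ^ 2 = 1 := by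
  have h := EuclideanSpace.norm_sq_eq (q : EuclideanSpace ℝ (Fin 3))
  rw [norm_eq_of_mem_sphere q] at h
  simp only [Fin.sum_univ_three, Real.norm_eq_abs, sq_abs] at h
  simp only [xc, yc, zc]
  linarith

theorem S2_ext {q r : S2} (hx : xc q = xc r) (hy : yc q = yc r) (hz : zc q = zc r) : q = r := by
  apply Subtype.ext
  ext i
  fin_cases i
  · exact hx
  · exact hy
  · exact hz

theorem xc_sphericalPoint (θ φ : ℝ) :
    xc (sphericalPoint θ φ) = -(Real.sin θ * Real.cos φ) := by simp [xc, sphericalPoint]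

theorem yc_sphericalPoint (θ φ : ℝ) :
    yc (sphericalPoint θ φ) = -(Real.sin θ * Real.sin φ) := by simp [yc, sphericalPoint]

theorem zc_sphericalPoint (θ φ : ℝ) : zc (sphericalPoint θ φ) = Real.cos θ := by
  simp [zc, sphericalPoint]

/-- Spherical coordinates on the hemisphere `x < 0`. -/
theorem sphericalPoint_arccos_arctan {q : S2} (hq : xc q < 0) :
    sphericalPoint (Real.arccos (zc q)) (Real.arctan (yc q / xc q)) = q := by
  have h := coord_sq_sum q
  have hz1 : -1 ≤ zc q := by nlinarith
  have hz2 : zc q ≤ 1 := by nlinarith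
  have hpos : 0 < xc q ^ 2 + yc q ^ 2 := by nlinarith
  have hs : Real.sqrt (1 - zc q ^ 2) = Real.sqrt (xc q ^ 2 + yc q ^ 2) := by
    congr 1; linarith
  have ht : Real.sqrt (1 + (yc q / xc q) ^ 2) = Real.sqrt (xc q ^ 2 + yc q ^ 2) / (-xc q) := by
    rw [eq_div_iff (by linarith), ← Real.sqrt_sq (by linarith : 0 ≤ -xc q),
      ← Real.sqrt_mul (by positivity)]
    congr 1
    have := hq.ne
    field_simp
  have hr : Real.sqrt (xc q ^ 2 + yc q ^ 2) ≠ 0 := (Real.sqrt_pos.2 hpos).ne'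
  have hx := hq.ne
  refine S2_ext ?_ ?_ ?_
  · rw [xc_sphericalPoint, Real.sin_arccos, Real.cos_arctan, hs, ht]
    field_simp
  · rw [yc_sphericalPoint, Real.sin_arccos, Real.sin_arctan, hs, ht]
    field_simp
  · rw [zc_sphericalPoint, Real.cos_arccos hz1 hz2]

theorem exists_sphericalPoint_eq {q : S2} (hq : zc q ^ 2 ≠ 1) :
    ∃ θ φ, Real.sin θ ≠ 0 ∧ sphericalPoint θ φ = q := by
  have h := coord_sq_sum q
  have hz1 : -1 ≤ zc q := by nlinarith
  have hz2 : zc q ≤ 1 := by nlinarith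
  have hlt : 0 < 1 - zc q ^ 2 := lt_of_le_of_ne (by nlinarith) fun h0 => hq (by linarith)
  -- In this convention `-x - i y = sin θ exp(i φ)`, so `φ` is the argument of that number and `sin
  -- θ` its norm.
  have hw : ‖(⟨-xc q, -yc q⟩ : ℂ)‖ = Real.sqrt (1 - zc q ^ 2) := by
    rw [Complex.norm_def, Complex.normSq_apply]
    congr 1
    simp only
    linarith
  refine ⟨Real.arccos (zc q), Complex.arg ⟨-xc q, -yc q⟩, ?_, S2_ext ?_ ?_ ?_⟩
  · rw [Real.sin_arccos]
    exact (Real.sqrt_pos.2 hlt).ne'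
  · rw [xc_sphericalPoint, Real.sin_arccos, ← hw, Complex.norm_mul_cos_arg, neg_neg]
  · rw [yc_sphericalPoint, Real.sin_arccos, ← hw, Complex.norm_mul_sin_arg, neg_neg]
  · rw [zc_sphericalPoint, Real.cos_arccos hz1 hz2]

/-- A bijection of the sphere sends some point off the poles into the hemisphere `x < 0`. -/
theorem exists_good_point (D : S2 ≃ S2) :
    ∃ θ φ, Real.sin θ ≠ 0 ∧ xc (D (sphericalPoint θ φ)) < 0 := by
  by_contra! hcon
  have hpole : ∀ q, xc q < 0 → xc (D.symm q) = 0 ∧ yc (D.symm q) = 0 ∧ zc (D.symm q) ^ 2 = 1 := by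
    intro q hq
    have hz : zc (D.symm q) ^ 2 = 1 := by
      by_contra hne
      obtain ⟨θ, φ, hs, he⟩ := exists_sphericalPoint_eq hne
      have := hcon θ φ hs
      rw [he, D.apply_symm_apply] at this
      linarith
    have h := coord_sq_sum (D.symm q)
    refine ⟨?_, ?_, hz⟩ <;> nlinarith
  have hinj : ∀ q r, xc q < 0 → xc r < 0 → zc (D.symm q) = zc (D.symm r) → zc q = zc r := by
    intro q r hq hr h
    obtain ⟨h1, h2, -⟩ := hpole q hq
    obtain ⟨h3, h4, -⟩ := hpole r hr
    rw [D.symm.injective (S2_ext (h1.trans h3.symm) (h2.trans h4.symm) h)]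
  have hneg : ∀ θ, 0 < Real.sin θ → xc (sphericalPoint θ 0) < 0 := by
    intro θ h
    rw [xc_sphericalPoint, Real.cos_zero]
    linarith
  -- Three distinct points with `x < 0` would have their preimages among the two poles.
  have n1 := hneg (Real.pi / 2) (by simp)
  have n2 := hneg (Real.pi / 3) (by simp)
  have n3 := hneg (Real.pi - Real.pi / 3) (by simp)
  have h12 := hinj _ _ n1 n2
  have h13 := hinj _ _ n1 n3
  have h23 := hinj _ _ n2 n3
  simp only [zc_sphericalPoint, Real.cos_pi_sub, Real.cos_pi_div_two,
    Real.cos_pi_div_three] at h12 h13 h23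
  norm_num at h12 h13 h23
  rcases sq_eq_sq_iff_eq_or_eq_neg.1 ((hpole _ n1).2.2.trans (one_pow 2).symm) with a | a <;>
  rcases sq_eq_sq_iff_eq_or_eq_neg.1 ((hpole _ n2).2.2.trans (one_pow 2).symm) with b | b <;>
  rcases sq_eq_sq_iff_eq_or_eq_neg.1 ((hpole _ n3).2.2.trans (one_pow 2).symm) with c | c <;>
  simp_all

/-! ### Push-forward of the kinetic energy in coordinates -/

/-- Spherical coordinates as a map of the plane to the sphere. -/
noncomputable def sphericalMap (x : ℝ × ℝ) : S2 := sphericalPoint x.1 x.2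

theorem contMDiff_sphericalMap : ContMDiff 𝓘(ℝ, ℝ × ℝ) (𝓡 2) ∞ sphericalMap := by
  have := finrank_three
  have hs : ContDiff ℝ ∞ (fun x => (sphericalMap x : EuclideanSpace ℝ (Fin 3))) := by
    rw [contDiff_euclidean]
    intro i; fin_cases i <;> simp [sphericalMap, sphericalPoint] <;> fun_prop
  exact ContMDiff.codRestrict_sphere (n := 2) hs.contMDiff (fun u => (sphericalMap u).2)

theorem mfderiv_sphericalMap (x w : ℝ × ℝ) :
    (mfderiv 𝓘(ℝ, ℝ × ℝ) (𝓡 2) sphericalMap x w : TangentSpace (𝓡 2) (sphericalMap x)) =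
      w.1 • velocity (fun t => sphericalPoint t x.2) x.1 +
        w.2 • velocity (fun t => sphericalPoint x.1 t) x.2 := by
  have hS : MDifferentiableAt 𝓘(ℝ, ℝ × ℝ) (𝓡 2) sphericalMap x :=
    (contMDiff_sphericalMap x).mdifferentiableAt (by simp)
  have h1 : velocity (fun t => sphericalPoint t x.2) x.1 =
      mfderiv 𝓘(ℝ, ℝ × ℝ) (𝓡 2) sphericalMap x (1, 0) := by
    have hd : HasFDerivAt (fun t : ℝ => (t, x.2)) (ContinuousLinearMap.inl ℝ ℝ ℝ) x.1 :=
      hasFDerivAt_prodMk_left _ _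
    have h := mfderiv_comp_apply (I := 𝓘(ℝ, ℝ)) (I' := 𝓘(ℝ, ℝ × ℝ)) (I'' := 𝓡 2)
      (f := fun t : ℝ => (t, x.2)) (g := sphericalMap) x.1 hS
      hd.differentiableAt.mdifferentiableAt (1 : ℝ)
    rw [mfderiv_eq_fderiv, hd.fderiv] at h
    exact h
  have h2 : velocity (fun t => sphericalPoint x.1 t) x.2 =
      mfderiv 𝓘(ℝ, ℝ × ℝ) (𝓡 2) sphericalMap x (0, 1) := by
    have hd : HasFDerivAt (fun t : ℝ => (x.1, t)) (ContinuousLinearMap.inr ℝ ℝ ℝ) x.2 :=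
      hasFDerivAt_prodMk_right _ _
    have h := mfderiv_comp_apply (I := 𝓘(ℝ, ℝ)) (I' := 𝓘(ℝ, ℝ × ℝ)) (I'' := 𝓡 2)
      (f := fun t : ℝ => (x.1, t)) (g := sphericalMap) x.2 hS
      hd.differentiableAt.mdifferentiableAt (1 : ℝ)
    rw [mfderiv_eq_fderiv, hd.fderiv] at h
    exact h
  rw [h1, h2]
  have hw : w = w.1 • ((1, 0) : ℝ × ℝ) + w.2 • ((0, 1) : ℝ × ℝ) := by simp
  conv_lhs => rw [hw]
  erw [map_add, map_smul, map_smul]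
  rfl

/-- Covectors with prescribed momenta. -/
theorem exists_covector {x : ℝ × ℝ} (hx : Real.sin x.1 ≠ 0) (ξ η : ℝ) :
    ∃ p : Cotangent (sphericalPoint x.1 x.2), pTheta x.1 x.2 p = ξ ∧ pPhi x.1 x.2 p = η := by
  set q := sphericalPoint x.1 x.2
  have h1 := Real.sin_sq_add_cos_sq x.1
  have h2 := Real.sin_sq_add_cos_sq x.2
  -- `∂θ` and `∂φ` are orthogonal in `ℝ³`, with squared lengths `1` and `sin² θ`; this explains the
  -- division.
  refine ⟨(innerSL ℝ (ξ • !₂[-(Real.cos x.1 * Real.cos x.2), -(Real.cos x.1 * Real.sin x.2),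
      -Real.sin x.1] + (η / Real.sin x.1 ^ 2) • !₂[Real.sin x.1 * Real.sin x.2,
      -(Real.sin x.1 * Real.cos x.2), 0])).comp (inclusionDeriv q), ?_, ?_⟩
  · change inner ℝ _ (inclusionDeriv q (velocity _ _)) = ξ
    rw [inclusionDeriv_velocity_theta]
    simp [PiLp.inner_apply, Fin.sum_univ_three]
    field_simp
    grind
  · change inner ℝ _ (inclusionDeriv q (velocity _ _)) = η
    rw [inclusionDeriv_velocity_phi]
    simp [PiLp.inner_apply, Fin.sum_univ_three]
    field_simp
    grind

/-- `K` in spherical coordinates, at a point merely equal to a point given by coordinates. -/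
theorem K_of_eq (s : ℝ) {r : S2} {x : ℝ × ℝ} (hr : r = sphericalMap x) (hx : Real.sin x.1 ≠ 0)
    (p : Cotangent r) :
    K s r p = (1 / 2) * (1 / Real.sin x.1 ^ 2 + G s (Real.cos x.1)) *
        p (mfderiv 𝓘(ℝ, ℝ × ℝ) (𝓡 2) sphericalMap x ((0, 1) : ℝ × ℝ)) ^ 2 +
      (1 / 2) * p (mfderiv 𝓘(ℝ, ℝ × ℝ) (𝓡 2) sphericalMap x ((1, 0) : ℝ × ℝ)) ^ 2 := by
  subst hr
  rw [mfderiv_sphericalMap, mfderiv_sphericalMap]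
  refine (K_sphericalPoint s x.1 x.2 hx p).trans ?_
  simp [pTheta, pPhi]
  rfl

/-- If `D.symm ∘ σ ∘ Ψ = σ` near `x` for spherical coordinates `σ`, the inverse of the differential
of `D.symm` is given by the differential of `Ψ`. -/
theorem mfderiv_symm_apply (D : S2 ≃ₘ⟮𝓡 2, 𝓡 2⟯ S2) {Ψ : ℝ × ℝ → ℝ × ℝ} {x : ℝ × ℝ}
    {Ψ' : ℝ × ℝ →L[ℝ] ℝ × ℝ} (hΨ : HasFDerivAt Ψ Ψ' x)
    (h : ∀ᶠ y in 𝓝 x, D.symm (sphericalMap (Ψ y)) = sphericalMap y) (w : ℝ × ℝ) :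
    (D.symm.mfderivToContinuousLinearEquiv (x := sphericalMap (Ψ x)) (by simp)).symm
        (mfderiv 𝓘(ℝ, ℝ × ℝ) (𝓡 2) sphericalMap x w) =
      (mfderiv 𝓘(ℝ, ℝ × ℝ) (𝓡 2) sphericalMap (Ψ x) (Ψ' w) :
        TangentSpace (𝓡 2) (sphericalMap (Ψ x))) := by
  have hS : MDifferentiableAt 𝓘(ℝ, ℝ × ℝ) (𝓡 2) sphericalMap (Ψ x) :=
    (contMDiff_sphericalMap _).mdifferentiableAt (by simp)
  have hP : MDifferentiableAt 𝓘(ℝ, ℝ × ℝ) 𝓘(ℝ, ℝ × ℝ) Ψ x :=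
    hΨ.differentiableAt.mdifferentiableAt
  have hD : MDifferentiableAt (𝓡 2) (𝓡 2) D.symm (sphericalMap (Ψ x)) :=
    (D.symm.contMDiff _).mdifferentiableAt (by simp)
  have hc := mfderiv_comp_apply (f := sphericalMap ∘ Ψ) (g := D.symm) x hD (hS.comp x hP) w
  have hc2 := mfderiv_comp_apply (f := Ψ) (g := sphericalMap) x hS hP w
  have he : mfderiv 𝓘(ℝ, ℝ × ℝ) (𝓡 2) (D.symm ∘ sphericalMap ∘ Ψ) x w =
      mfderiv 𝓘(ℝ, ℝ × ℝ) (𝓡 2) sphericalMap x w := by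
    have : (D.symm ∘ sphericalMap ∘ Ψ) =ᶠ[𝓝 x] sphericalMap := h
    exact congrArg (fun L : ℝ × ℝ →L[ℝ] EuclideanSpace ℝ (Fin 2) => L w) this.mfderiv_eq
  rw [mfderiv_eq_fderiv, hΨ.fderiv] at hc2
  refine (ContinuousLinearEquiv.symm_apply_eq _).2 ?_
  exact he.symm.trans (hc.trans (congrArg _ hc2))

/-- Covectors are pulled back by the transpose of `Ψ'`: the momenta at the source point are the
pairings of `p` with the columns of `Ψ'`. -/
theorem pushforward_K_sphericalMap (s : ℝ) (D : S2 ≃ₘ⟮𝓡 2, 𝓡 2⟯ S2) {Ψ : ℝ × ℝ → ℝ × ℝ}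
    {x : ℝ × ℝ} {Ψ' : ℝ × ℝ →L[ℝ] ℝ × ℝ} (hΨ : HasFDerivAt Ψ Ψ' x)
    (h : ∀ᶠ y in 𝓝 x, D.symm (sphericalMap (Ψ y)) = sphericalMap y) (hx : Real.sin x.1 ≠ 0)
    (p : Cotangent (sphericalPoint (Ψ x).1 (Ψ x).2)) :
    pushforward D (K s) (sphericalPoint (Ψ x).1 (Ψ x).2) p =
      (1 / 2) * (1 / Real.sin x.1 ^ 2 + G s (Real.cos x.1)) *
        ((Ψ' (0, 1)).1 * pTheta (Ψ x).1 (Ψ x).2 p + (Ψ' (0, 1)).2 * pPhi (Ψ x).1 (Ψ x).2 p) ^ 2 +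
      (1 / 2) * ((Ψ' (1, 0)).1 * pTheta (Ψ x).1 (Ψ x).2 p +
        (Ψ' (1, 0)).2 * pPhi (Ψ x).1 (Ψ x).2 p) ^ 2 := by
  refine (K_of_eq s h.self_of_nhds hx _).trans ?_
  have key : ∀ w : ℝ × ℝ, (p.comp ((D.symm.mfderivToContinuousLinearEquiv
      (x := sphericalMap (Ψ x)) (by simp)).symm :
        TangentSpace (𝓡 2) (D.symm (sphericalMap (Ψ x))) →L[ℝ]
          TangentSpace (𝓡 2) (sphericalMap (Ψ x))))
      (mfderiv 𝓘(ℝ, ℝ × ℝ) (𝓡 2) sphericalMap x w) =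
      (Ψ' w).1 * pTheta (Ψ x).1 (Ψ x).2 p + (Ψ' w).2 * pPhi (Ψ x).1 (Ψ x).2 p := by
    intro w
    refine (congrArg p ((mfderiv_symm_apply D hΨ h w).trans
      (mfderiv_sphericalMap (Ψ x) (Ψ' w)))).trans ?_
    erw [map_add, map_smul, map_smul]
    rfl
  rw [← key, ← key]
  rfl

/-- Excludes `α = 0`. The cotangent lift of `D` is onto, so a zero push-forward would make `K`
vanish identically, yet `K = 1 / 2` where `p_θ = 1` and `p_φ = 0`. -/
theorem pushforward_K_ne_zero (s : ℝ) (D : S2 ≃ₘ⟮𝓡 2, 𝓡 2⟯ S2) {x : ℝ × ℝ}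
    (hx : Real.sin x.1 ≠ 0) : pushforward D (K s) ≠ 0 := by
  intro h0
  obtain ⟨p, hp1, hp2⟩ := exists_covector hx 1 0
  obtain ⟨q, hq⟩ := D.symm.surjective (sphericalPoint x.1 x.2)
  have hall : ∀ p' : Cotangent (D.symm q), K s (D.symm q) p' = 0 := by
    intro p'
    set e := D.symm.mfderivToContinuousLinearEquiv (x := q) (by simp)
    have h1 := congrFun (congrFun h0 q)
      (p'.comp (e : TangentSpace (𝓡 2) q →L[ℝ] TangentSpace (𝓡 2) (D.symm q)))
    have h2 : (p'.comp (e : TangentSpace (𝓡 2) q →L[ℝ] TangentSpace (𝓡 2) (D.symm q))).comp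
        (e.symm : TangentSpace (𝓡 2) (D.symm q) →L[ℝ] TangentSpace (𝓡 2) q) = p' := by
      ext v
      exact congrArg p' (e.apply_symm_apply v)
    have h3 : K s (D.symm q) ((p'.comp (e : TangentSpace (𝓡 2) q →L[ℝ]
        TangentSpace (𝓡 2) (D.symm q))).comp
        (e.symm : TangentSpace (𝓡 2) (D.symm q) →L[ℝ] TangentSpace (𝓡 2) q)) = 0 := h1
    rwa [h2] at h3
  replace hq : D.symm q = sphericalPoint x.1 x.2 := hq
  rw [hq] at hall
  have := hall p
  rw [K_sphericalPoint s x.1 x.2 hx, hp1, hp2] at this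
  norm_num at this

/-! ### Global inequivalence -/

/-- The kinetic energies of the two systems are not related by any diffeomorphism, even up to a
constant factor. -/
theorem pushforward_K_ne {s : ℝ} (hs : 1 < s) (D : S2 ≃ₘ⟮𝓡 2, 𝓡 2⟯ S2) (α : ℝ) :
    pushforward D (K s) ≠ α • K₁ := by
  intro hK
  obtain ⟨θ₀, φ₀, hθ₀, hx₀⟩ := exists_good_point D.toEquiv
  have hα : α ≠ 0 := by
    rintro rfl
    rw [zero_smul] at hK
    exact pushforward_K_ne_zero s D (x := (θ₀, φ₀)) hθ₀ hK
  have := finrank_three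
  have hΓ : ContDiff ℝ ∞ (fun x => (D (sphericalMap x) : EuclideanSpace ℝ (Fin 3))) :=
    ((contMDiff_coe_sphere (n := 2) (m := ∞)).comp
      (D.contMDiff.comp contMDiff_sphericalMap)).contDiff
  have hcx : ContDiff ℝ ∞ (fun x => xc (D (sphericalMap x))) := contDiff_euclidean.1 hΓ 0
  have hcy : ContDiff ℝ ∞ (fun x => yc (D (sphericalMap x))) := contDiff_euclidean.1 hΓ 1
  have hcz : ContDiff ℝ ∞ (fun x => zc (D (sphericalMap x))) := contDiff_euclidean.1 hΓ 2
  -- On `O` the source point is not a pole and the image lies in `x < 0`, where `arccos` and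
  -- `arctan` give smooth coordinates.
  set O : Set (ℝ × ℝ) := {x | Real.sin x.1 ≠ 0 ∧ xc (D (sphericalMap x)) < 0} with hOdef
  have hO : IsOpen O :=
    (isOpen_ne_fun (Real.continuous_sin.comp continuous_fst) continuous_const).inter
      (isOpen_lt hcx.continuous continuous_const)
  have hzlt : ∀ x ∈ O, zc (D (sphericalMap x)) ^ 2 < 1 := by
    intro x hx
    have h := coord_sq_sum (D (sphericalMap x))
    have := hx.2
    nlinarith
  set T : ℝ × ℝ → ℝ := fun x => Real.arccos (zc (D (sphericalMap x))) with hTdef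
  set F : ℝ × ℝ → ℝ := fun x =>
    Real.arctan (yc (D (sphericalMap x)) / xc (D (sphericalMap x))) with hFdef
  have hT : ContDiffOn ℝ ∞ T O := by
    intro x hx
    have h := hzlt x hx
    refine ContDiffAt.contDiffWithinAt (ContDiffAt.comp (g := Real.arccos) x (Real.contDiffAt_arccos ?_ ?_)
      hcz.contDiffAt)
    · intro h1; rw [h1] at h; norm_num at h
    · intro h1; rw [h1] at h; norm_num at h
  have hF : ContDiffOn ℝ ∞ F O := fun x hx =>
    ((hcy.contDiffAt.div hcx.contDiffAt hx.2.ne).arctan).contDiffWithinAt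
  have hDT : ∀ x ∈ O, HasFDerivAt T (fderiv ℝ T x) x := fun x hx =>
    ((hT.contDiffAt (hO.mem_nhds hx)).differentiableAt (by simp)).hasFDerivAt
  have hDF : ∀ x ∈ O, HasFDerivAt F (fderiv ℝ F x) x := fun x hx =>
    ((hF.contDiffAt (hO.mem_nhds hx)).differentiableAt (by simp)).hasFDerivAt
  have hsymm : ∀ x ∈ O, D.symm (sphericalMap (T x, F x)) = sphericalMap x := by
    intro x hx
    have : sphericalMap (T x, F x) = D (sphericalMap x) := sphericalPoint_arccos_arctan hx.2
    rw [this, D.symm_apply_apply]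
  have hsinT : ∀ x ∈ O, Real.sin (T x) ≠ 0 := by
    intro x hx
    rw [hTdef, Real.sin_arccos]
    exact (Real.sqrt_pos.2 (by linarith [hzlt x hx])).ne'
  have hmain : ∀ x ∈ O, ∀ ξ η : ℝ,
      (1 / Real.sin x.1 ^ 2 + G s (Real.cos x.1)) *
        (fderiv ℝ T x (0, 1) * ξ + fderiv ℝ F x (0, 1) * η) ^ 2 +
      (fderiv ℝ T x (1, 0) * ξ + fderiv ℝ F x (1, 0) * η) ^ 2 =
        α * ((1 / Real.sin (T x) ^ 2 + 3) * η ^ 2 + ξ ^ 2) := by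
    intro x hx ξ η
    have hs0 := hsinT x hx
    obtain ⟨p, hp1, hp2⟩ := exists_covector (x := (T x, F x)) hs0 ξ η
    have h1 := pushforward_K_sphericalMap s D (Ψ := fun x => (T x, F x))
      ((hDT x hx).prodMk (hDF x hx)) (eventually_of_mem (hO.mem_nhds hx) hsymm) hx.1 p
    rw [hK] at h1
    have h2 : (α • K₁) (sphericalPoint (T x) (F x)) p = α * K₁ (sphericalPoint (T x) (F x)) p := rfl
    rw [h2, K₁_sphericalPoint _ _ hs0, hp1, hp2, Real.cos_sq'] at h1
    simp only [ContinuousLinearMap.prod_apply] at h1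
    have h3 : (1 - Real.sin (T x) ^ 2) / Real.sin (T x) ^ 2 + 4 =
        1 / Real.sin (T x) ^ 2 + 3 := by field_simp; ring
    rw [h3] at h1
    linear_combination -2 * h1
  -- `hmain` equates two quadratic forms in `(ξ, η)`; polarization at `(1, 0)`, `(1, 1)`, `(0, 1)`
  -- extracts the three coefficients.
  refine no_local_equivalence hs hα hO (x₀ := (θ₀, φ₀)) ⟨hθ₀, hx₀⟩ hT hF (fun x hx => hx.1) hsinT
    (fun x hx => ?_) (fun x hx => ?_) (fun x hx => ?_)
  · linear_combination hmain x hx 1 0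
  · linear_combination (hmain x hx 1 1 - hmain x hx 1 0 - hmain x hx 0 1) / 2
  · linear_combination hmain x hx 0 1

end SphereSystem

open SphereSystem in
theorem mainTheorem3 (s A c A₁ : ℝ) (hs : 1 < s) :
    (¬ ∃ (D : SphereSystem.S2 ≃ₘ⟮𝓡 2, 𝓡 2⟯ SphereSystem.S2) (α β : ℝ),
        SphereSystem.pushforward D (SphereSystem.K s) = α • SphereSystem.K₁ ∧
        SphereSystem.pushforwardBase D (SphereSystem.V s A c) = β • SphereSystem.V₁ A₁) ∧
    (¬ ∃ (D : SphereSystem.S2 ≃ₘ⟮𝓡 2, 𝓡 2⟯ SphereSystem.S2) (α : ℝ),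
        SphereSystem.pushforward D (SphereSystem.H s A c) = α • SphereSystem.H₁ A₁) := by
  refine ⟨fun ⟨D, α, β, hK, _⟩ => pushforward_K_ne hs D α hK, fun ⟨D, α, hH⟩ => ?_⟩
  refine pushforward_K_ne hs D α ?_
  funext q p
  have h1 := congrFun (congrFun hH q) p
  -- At the zero covector only the potentials remain; subtracting this leaves the relation between
  -- the kinetic energies.
  have h0 := congrFun (congrFun hH q) 0
  simp only [pushforward, H, Pi.smul_apply, H₁, smul_eq_mul, ContinuousLinearMap.zero_comp] at h1 h0
  have hK0 : ∀ r, K s r 0 = 0 := fun r => by simp [K, Lx, Ly, Lz]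
  have hK10 : K₁ q 0 = 0 := by simp [K₁, Lx, Ly, Lz]
  rw [hK0, hK10] at h0
  simp only [pushforward, Pi.smul_apply, smul_eq_mul]
  linarith
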